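/- A \emph{variety} is the class of all (nonempty) algebras with a given family of finitary operation symbols that satisfy a given set of identities. A \emph{tolerance} of an algebra $A$ is a reflexive, symmetric binary relation on $A$ that is compatible with the operations of $A$. A tolerance $\Theta$ of $A$ is \emph{representable} if $\Theta = R\circ R^{-}$ for some reflexive compatible relation $R$ on $A$, where $R^{-}$ is the converse of $R$; it is \emph{weakly representable} if $\Theta=\bigcap_{k\in K}(R_k\circ R_k^{-})$ for some family $(R_k)_{k\in K}$, possibly infinite, of reflexive compatible relations on $A$. A \emph{strong Mal'cev condition} consists of finitely many operation symbols and finitely many identities in them; a variety $\mathcal V$ satisfies it if the symbols can be interpreted by terms of $\mathcal V$ of the same arities so that the identities hold in every algebra of $\mathcal V$. A \emph{Mal'cev condition} is a sequence $(S_n)_{n\in\mathbb N}$ of strong Mal'cev conditions such that every variety satisfying $S_n$ satisfies $S_{n+1}$; a variety satisfies it if it satisfies $S_n$ for some $n$. A \emph{weak Mal'cev condition} is a countable family of Mal'cev conditions; a variety satisfies it if it satisfies all of them. A class of varieties is \emph{characterized} by a weak Mal'cev condition if it consists of exactly the varieties that satisfy the condition. (i) The class of varieties $\mathcal V$ such that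 every tolerance of every algebra in $\mathcal V$ is representable cannot be characterized by a weak Mal'cev condition. (ii) The class of varieties $\mathcal V$ such that every tolerance of every algebra in $\mathcal V$ is weakly representable cannot be characterized by a weak Mal'cev condition. -/

import Mathlib

universe u v w

namespace UnivAlg

/-! An algebra is a structure for a first-order language without relation symbols
(`FirstOrder.Language.IsAlgebraic`). Compatible relations, tolerances and their representations. -/

section Relations

variable (L : FirstOrder.Language.{v, w}) {A : Type u} [L.Structure A]

/-- A binary relation preserved by all basic operations of the algebra `A`. -/
def Compatible (R : A → A → Prop) : Prop :=
  ∀ (n : ℕ) (f : L.Functions n) (x y : Fin n → A),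
    (∀ i, R (x i) (y i)) → R (FirstOrder.Language.Structure.funMap f x)
      (FirstOrder.Language.Structure.funMap f y)

/-- A tolerance of `A`: a reflexive, symmetric and compatible relation. -/
structure IsTolerance (Θ : A → A → Prop) : Prop where
  refl : ∀ a, Θ a a
  symm : ∀ a b, Θ a b → Θ b a
  compatible : Compatible L Θ

/-- `Θ = R ∘ R⁻` for some compatible and reflexive relation `R`, where `R⁻` is the converse. -/
def IsRepresentable (Θ : A → A → Prop) : Prop :=
  ∃ R : A → A → Prop, (∀ a, R a a) ∧ Compatible L R ∧
    ∀ a b, Θ a b ↔ Relation.Comp R (flip R) a b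

/-- `Θ = ⋂ k, R k ∘ (R k)⁻` for some family of compatible and reflexive relations `R k`. -/
def IsWeaklyRepresentable (Θ : A → A → Prop) : Prop :=
  ∃ (K : Type u) (R : K → A → A → Prop), (∀ k a, R k a a) ∧ (∀ k, Compatible L (R k)) ∧
    ∀ a b, Θ a b ↔ ∀ k, Relation.Comp (R k) (flip (R k)) a b

end Relations

/-- An identity `s ≈ t` between terms in countably many variables. -/
abbrev Identity (L : FirstOrder.Language.{v, w}) : Type v := L.Term ℕ × L.Term ℕ

/-- The algebra `A` satisfies the identity `e`. -/
def Holds {L : FirstOrder.Language.{v, w}} (A : Type u) [L.Structure A] (e : Identity L) : Prop :=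
  ∀ x : ℕ → A, e.1.realize x = e.2.realize x

/-- A variety (equational class), given by its operation symbols and a set of defining
identities. There is no restriction on the number of operation symbols. -/
structure Variety where
  lang : FirstOrder.Language.{u, 0}
  isAlgebraic : lang.IsAlgebraic
  identities : Set (Identity lang)

/-- The (nonempty) algebra `A` belongs to the variety `V`. -/
def Variety.Mem (V : Variety.{u}) (A : Type u) [V.lang.Structure A] : Prop :=
  Nonempty A ∧ ∀ e ∈ V.identities, Holds A e

/-- Every tolerance of every algebra in `V` is representable. -/
def Variety.TolerancesRepresentable (V : Variety.{u}) : Prop :=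
  ∀ (A : Type u) [V.lang.Structure A], V.Mem A →
    ∀ Θ : A → A → Prop, IsTolerance V.lang Θ → IsRepresentable V.lang Θ

/-- Every tolerance of every algebra in `V` is weakly representable. -/
def Variety.TolerancesWeaklyRepresentable (V : Variety.{u}) : Prop :=
  ∀ (A : Type u) [V.lang.Structure A], V.Mem A →
    ∀ Θ : A → A → Prop, IsTolerance V.lang Θ → IsWeaklyRepresentable V.lang Θ

/-- A strong Mal'cev condition: finitely many operation symbols and finitely many identities
in them, asserting that there are terms satisfying the identities. -/
structure StrongMalcevCondition where
  lang : FirstOrder.Language.{0, 0}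
  isAlgebraic : lang.IsAlgebraic
  finite_symbols : Finite (Σ n, lang.Functions n)
  identities : Set (Identity lang)
  finite_identities : identities.Finite

/-- Given an assignment of an `n`-ary term of `L` to each `n`-ary operation symbol of `M`, every
algebra `A` for `L` becomes an algebra for `M` by evaluating these terms. -/
@[reducible] def termReduct {M : FirstOrder.Language.{0, 0}} [M.IsAlgebraic]
    {L : FirstOrder.Language.{v, w}}
    (t : ∀ n, M.Functions n → L.Term (Fin n)) (A : Type u) [L.Structure A] : M.Structure A where
  funMap {n} f x := (t n f).realize x
  RelMap {_} r := isEmptyElim r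

/-- `V` satisfies the strong Mal'cev condition `S`: the operation symbols of `S` can be interpreted
by terms of `V` in such a way that the identities of `S` hold in all algebras of `V`. -/
def Variety.SatisfiesStrong (V : Variety.{u}) (S : StrongMalcevCondition) : Prop :=
  haveI := S.isAlgebraic
  ∃ t : ∀ n, S.lang.Functions n → V.lang.Term (Fin n),
    ∀ (A : Type u) [V.lang.Structure A], V.Mem A →
      ∀ e ∈ S.identities, @Holds S.lang A (termReduct t A) e

/-- A Mal'cev condition: a sequence of strong Mal'cev conditions, each one implying the next one;
it asserts that one of them is satisfied. -/
structure MalcevCondition where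
  cond : ℕ → StrongMalcevCondition
  imp_succ : ∀ (n : ℕ) (V : Variety.{u}),
    V.SatisfiesStrong (cond n) → V.SatisfiesStrong (cond (n + 1))

def Variety.SatisfiesMalcev (V : Variety.{u}) (M : MalcevCondition.{u}) : Prop :=
  ∃ n, V.SatisfiesStrong (M.cond n)

/-- A weak Mal'cev condition: the conjunction of countably many Mal'cev conditions. -/
structure WeakMalcevCondition where
  conj : ℕ → MalcevCondition.{u}

def Variety.SatisfiesWeakMalcev (V : Variety.{u}) (W : WeakMalcevCondition.{u}) : Prop :=
  ∀ i, V.SatisfiesMalcev (W.conj i)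

/-- The class `C` of varieties consists exactly of the varieties satisfying some
weak Mal'cev condition. -/
def CharacterizedByWeakMalcev (C : Variety.{u} → Prop) : Prop :=
  ∃ W : WeakMalcevCondition.{u}, ∀ V : Variety.{u}, C V ↔ V.SatisfiesWeakMalcev W

end UnivAlg

namespace UnivAlg

open FirstOrder FirstOrder.Language

/-! ### Transfer of Mal'cev conditions along an expansion of the language -/

/-! Weak Mal'cev conditions only assert that certain terms exist, so they persist when operations
and identities are added to a variety (`Variety.SatisfiesWeakMalcev.of_lhom`). Representability of
tolerances does not persist: new operations must also preserve the representing relations `R`, not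
just the tolerance. Lattices have all tolerances representable, yet two extra unary operations on a
three-element chain can preserve a tolerance while destroying even its weak representability. Since
representable implies weakly representable, this one pair of varieties settles both claims. -/

theorem Holds.of_onTerm {L L' : FirstOrder.Language} (φ : L →ᴸ L') {A : Type*} [L.Structure A]
    [L'.Structure A] [φ.IsExpansionOn A] {e : Identity L}
    (h : Holds A ((φ.onTerm e.1, φ.onTerm e.2) : Identity L')) : Holds A e := fun x => by
  simpa only [LHom.realize_onTerm] using h x

/-- The reduct along `φ` of an algebra in `V'` lies in `V`, and the translated terms induce the same
operations on it as the original ones. -/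
theorem Variety.SatisfiesStrong.of_lhom {V V' : Variety.{u}} (φ : V.lang →ᴸ V'.lang)
    (hφ : ∀ e ∈ V.identities, ((φ.onTerm e.1, φ.onTerm e.2) : Identity V'.lang) ∈ V'.identities)
    {S : StrongMalcevCondition} (h : V.SatisfiesStrong S) : V'.SatisfiesStrong S := by
  have := S.isAlgebraic
  have := V.isAlgebraic
  obtain ⟨t, ht⟩ := h
  refine ⟨fun n f => φ.onTerm (t n f), fun A _ hA e he => ?_⟩
  let _ : V.lang.Structure A := φ.reduct A
  have : φ.IsExpansionOn A := φ.isExpansionOn_reduct A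
  have hmem : V.Mem A := ⟨hA.1, fun e he => Holds.of_onTerm φ (hA.2 _ (hφ e he))⟩
  have hred : termReduct (fun n f => φ.onTerm (t n f)) A = termReduct t A := by
    simp only [termReduct, LHom.realize_onTerm]
  rw [hred]
  exact ht A hmem e he

theorem Variety.SatisfiesWeakMalcev.of_lhom {V V' : Variety.{u}} (φ : V.lang →ᴸ V'.lang)
    (hφ : ∀ e ∈ V.identities, ((φ.onTerm e.1, φ.onTerm e.2) : Identity V'.lang) ∈ V'.identities)
    {W : WeakMalcevCondition.{u}} (h : V.SatisfiesWeakMalcev W) : V'.SatisfiesWeakMalcev W :=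
  fun i => (h i).imp fun _ hn => hn.of_lhom φ hφ

theorem IsRepresentable.isWeaklyRepresentable {L : FirstOrder.Language} {A : Type u} [L.Structure A]
    {Θ : A → A → Prop} (h : IsRepresentable L Θ) : IsWeaklyRepresentable L Θ := by
  obtain ⟨R, hr, hc, hR⟩ := h
  exact ⟨PUnit, fun _ => R, fun _ => hr, fun _ => hc, fun a b => (hR a b).trans (by simp)⟩

theorem Variety.TolerancesRepresentable.tolerancesWeaklyRepresentable {V : Variety.{u}}
    (h : V.TolerancesRepresentable) : V.TolerancesWeaklyRepresentable :=
  fun A _ hA Θ hΘ => (h A hA Θ hΘ).isWeaklyRepresentable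

/-! ### The variety of lattices -/

/-- The operation symbols of lattices. -/
inductive LatticeFunctions : ℕ → Type u
  | sup : LatticeFunctions 2
  | inf : LatticeFunctions 2

/-- The language of lattices. -/
def latticeLang : FirstOrder.Language.{u, 0} := ⟨LatticeFunctions, fun _ => Empty⟩

theorem latticeLang_isAlgebraic : latticeLang.{u}.IsAlgebraic :=
  fun _ => inferInstanceAs (IsEmpty Empty)

/-- The join of two terms. -/
def supTerm (s t : latticeLang.{u}.Term ℕ) : latticeLang.{u}.Term ℕ :=
  Functions.apply₂ (L := latticeLang) LatticeFunctions.sup s t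

/-- The meet of two terms. -/
def infTerm (s t : latticeLang.{u}.Term ℕ) : latticeLang.{u}.Term ℕ :=
  Functions.apply₂ (L := latticeLang) LatticeFunctions.inf s t

/-- The identities defining lattices. -/
inductive LatticeIdentity : Identity latticeLang.{u} → Prop
  | sup_comm : LatticeIdentity
      (supTerm (Term.var 0) (Term.var 1), supTerm (Term.var 1) (Term.var 0))
  | inf_comm : LatticeIdentity
      (infTerm (Term.var 0) (Term.var 1), infTerm (Term.var 1) (Term.var 0))
  | sup_assoc : LatticeIdentity
      (supTerm (supTerm (Term.var 0) (Term.var 1)) (Term.var 2),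
        supTerm (Term.var 0) (supTerm (Term.var 1) (Term.var 2)))
  | inf_assoc : LatticeIdentity
      (infTerm (infTerm (Term.var 0) (Term.var 1)) (Term.var 2),
        infTerm (Term.var 0) (infTerm (Term.var 1) (Term.var 2)))
  | sup_inf_self : LatticeIdentity
      (supTerm (Term.var 0) (infTerm (Term.var 0) (Term.var 1)), Term.var 0)
  | inf_sup_self : LatticeIdentity
      (infTerm (Term.var 0) (supTerm (Term.var 0) (Term.var 1)), Term.var 0)

/-- The variety of lattices. -/
def latticeVariety : Variety.{u} := ⟨latticeLang.{u}, latticeLang_isAlgebraic.{u},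
  {e | LatticeIdentity.{u} e}⟩

section Lattice

variable {A : Type u} [latticeLang.{u}.Structure A]

/-- The join operation of a `latticeLang`-algebra. -/
def supOp (a b : A) : A := Structure.funMap (L := latticeLang.{u}) LatticeFunctions.sup ![a, b]

/-- The meet operation of a `latticeLang`-algebra. -/
def infOp (a b : A) : A := Structure.funMap (L := latticeLang.{u}) LatticeFunctions.inf ![a, b]

theorem realize_supTerm (s t : latticeLang.{u}.Term ℕ) (x : ℕ → A) :
    (supTerm s t).realize x = supOp (s.realize x) (t.realize x) :=
  Term.realize_functions_apply₂

theorem realize_infTerm (s t : latticeLang.{u}.Term ℕ) (x : ℕ → A) :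
    (infTerm s t).realize x = infOp (s.realize x) (t.realize x) :=
  Term.realize_functions_apply₂

/-- The order-theoretic lattice on an algebra satisfying the lattice identities. -/
@[reducible] def latticeOfHolds (h : ∀ e : Identity latticeLang.{u}, LatticeIdentity e → Holds A e) :
    Lattice A :=
  letI : Max A := ⟨supOp⟩
  letI : Min A := ⟨infOp⟩
  have key (a b c : A) {e : Identity latticeLang.{u}} (he : LatticeIdentity e) :
      e.1.realize (fun n => if n = 0 then a else if n = 1 then b else c) =
        e.2.realize (fun n => if n = 0 then a else if n = 1 then b else c) := h e he _
  Lattice.mk'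
    (fun a b => show supOp a b = supOp b a by
      simpa [realize_supTerm] using key a b a .sup_comm)
    (fun a b c => show supOp (supOp a b) c = supOp a (supOp b c) by
      simpa [realize_supTerm] using key a b c .sup_assoc)
    (fun a b => show infOp a b = infOp b a by
      simpa [realize_infTerm] using key a b a .inf_comm)
    (fun a b c => show infOp (infOp a b) c = infOp a (infOp b c) by
      simpa [realize_infTerm] using key a b c .inf_assoc)
    (fun a b => show supOp a (infOp a b) = a by
      simpa [realize_supTerm, realize_infTerm] using key a b a .sup_inf_self)
    (fun a b => show infOp a (supOp a b) = a by
      simpa [realize_supTerm, realize_infTerm] using key a b a .inf_sup_self)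

theorem compatible_latticeLang_iff {R : A → A → Prop} :
    Compatible latticeLang.{u} R ↔
      (∀ a b c d, R a b → R c d → R (supOp a c) (supOp b d)) ∧
        ∀ a b c d, R a b → R c d → R (infOp a c) (infOp b d) := by
  constructor
  · intro h
    exact ⟨fun a b c d hab hcd => h 2 .sup _ _ (Fin.forall_fin_two.2 ⟨hab, hcd⟩),
      fun a b c d hab hcd => h 2 .inf _ _ (Fin.forall_fin_two.2 ⟨hab, hcd⟩)⟩
  · rintro ⟨hs, hi⟩ n f x y hxy
    have eta (z : Fin 2 → A) : z = ![z 0, z 1] := by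
      funext i; fin_cases i <;> rfl
    cases f with
    | sup => rw [eta x, eta y]; exact hs _ _ _ _ (hxy 0) (hxy 1)
    | inf => rw [eta x, eta y]; exact hi _ _ _ _ (hxy 0) (hxy 1)

end Lattice

/-- A tolerance `Θ` of a lattice is represented by `{(a, b) | a ≤ b, a Θ b}`. -/
theorem latticeVariety_tolerancesRepresentable :
    latticeVariety.{u}.TolerancesRepresentable := by
  intro A (_ : latticeLang.{u}.Structure A) hA Θ (hΘ : IsTolerance latticeLang.{u} Θ)
  let _ : Lattice A := latticeOfHolds hA.2
  obtain ⟨hsup, hinf⟩ := compatible_latticeLang_iff.1 hΘ.compatible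
  replace hsup : ∀ a b c d : A, Θ a b → Θ c d → Θ (a ⊔ c) (b ⊔ d) := hsup
  replace hinf : ∀ a b c d : A, Θ a b → Θ c d → Θ (a ⊓ c) (b ⊓ d) := hinf
  refine ⟨fun a b => a ≤ b ∧ Θ a b, fun a => ⟨le_rfl, hΘ.refl a⟩,
    compatible_latticeLang_iff.2 ⟨?_, ?_⟩, fun a b => ⟨fun hab => ⟨a ⊔ b, ?_, ?_⟩, ?_⟩⟩
  · exact fun a b c d hab hcd => ⟨sup_le_sup hab.1 hcd.1, hsup _ _ _ _ hab.2 hcd.2⟩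
  · exact fun a b c d hab hcd => ⟨inf_le_inf hab.1 hcd.1, hinf _ _ _ _ hab.2 hcd.2⟩
  -- Joining `a Θ a` with `a Θ b` gives `a Θ a ⊔ b`; the next step is the same for `b`.
  · exact ⟨le_sup_left, by simpa using hsup _ _ _ _ (hΘ.refl a) hab⟩
  · exact ⟨le_sup_right, by simpa using hsup _ _ _ _ (hΘ.symm _ _ hab) (hΘ.refl b)⟩
  · rintro ⟨c, ⟨hac, hac'⟩, hbc, hbc'⟩
    -- Meeting `a Θ c` with `c Θ b` gives `a = a ⊓ c Θ c ⊓ b = b`.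
    simpa [inf_eq_left.2 hac, inf_eq_right.2 hbc] using hinf _ _ _ _ hac' (hΘ.symm _ _ hbc')

/-! ### Lattices with two unary operations -/

/-- The operation symbols of lattices with two additional unary operations. -/
inductive ExpandedFunctions : ℕ → Type u
  | sup : ExpandedFunctions 2
  | inf : ExpandedFunctions 2
  | down : ExpandedFunctions 1
  | up : ExpandedFunctions 1

/-- The language of lattices with two additional unary operations. -/
def expandedLang : FirstOrder.Language.{u, 0} := ⟨ExpandedFunctions, fun _ => Empty⟩

theorem expandedLang_isAlgebraic : expandedLang.{u}.IsAlgebraic :=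
  fun _ => inferInstanceAs (IsEmpty Empty)

/-- The inclusion of the language of lattices. -/
def latticeInclusion : latticeLang.{u} →ᴸ expandedLang.{u} where
  onFunction := fun {_} f => match f with
    | .sup => ExpandedFunctions.sup
    | .inf => ExpandedFunctions.inf
  onRelation := fun {_} r => r

/-- The variety of lattices with two arbitrary additional unary operations. -/
def expandedVariety : Variety.{u} where
  lang := expandedLang.{u}
  isAlgebraic := expandedLang_isAlgebraic.{u}
  identities := {e' | ∃ e, LatticeIdentity.{u} e ∧
    e' = (latticeInclusion.{u}.onTerm e.1, latticeInclusion.{u}.onTerm e.2)}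

/-- The three-element chain in which `down` and `up` send the middle element to the bottom and to
the top respectively, and everything else to the middle. -/
instance chainStructure : expandedLang.{u}.Structure (ULift.{u} (Fin 3)) where
  funMap {_} f := match f with
    | .sup => fun x => x 0 ⊔ x 1
    | .inf => fun x => x 0 ⊓ x 1
    | .down => fun x => if x 0 = ⟨1⟩ then ⟨0⟩ else ⟨1⟩
    | .up => fun x => if x 0 = ⟨1⟩ then ⟨2⟩ else ⟨1⟩
  RelMap {_} r := isEmptyElim (α := Empty) r

theorem expandedVariety_mem_chain :
    @Variety.Mem expandedVariety.{u} (ULift.{u} (Fin 3)) chainStructure := by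
  refine ⟨⟨⟨0⟩⟩, ?_⟩
  rintro _ ⟨e, he, rfl⟩ x
  let _ : latticeLang.{u}.Structure (ULift.{u} (Fin 3)) := latticeInclusion.reduct _
  have : latticeInclusion.{u}.IsExpansionOn (ULift.{u} (Fin 3)) :=
    latticeInclusion.isExpansionOn_reduct _
  have hs (a b : ULift.{u} (Fin 3)) : supOp a b = a ⊔ b := rfl
  have hi (a b : ULift.{u} (Fin 3)) : infOp a b = a ⊓ b := rfl
  refine (LHom.realize_onTerm latticeInclusion e.1 x).trans
    (Eq.trans ?_ (LHom.realize_onTerm latticeInclusion e.2 x).symm)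
  cases he <;> simp only [realize_supTerm, realize_infTerm, Term.realize_var, hs, hi]
  · exact sup_comm _ _
  · exact inf_comm _ _
  · exact sup_assoc _ _ _
  · exact inf_assoc _ _ _
  · exact sup_inf_self
  · exact inf_sup_self

/-- The relation on the three-element chain connecting all pairs except bottom and top. -/
def chainTolerance (a b : ULift.{u} (Fin 3)) : Prop :=
  a.down.val ≤ b.down.val + 1 ∧ b.down.val ≤ a.down.val + 1

/-- `down` takes values only in {0, 1} and `up` only in {1, 2}, so any two values of the same unary
operation are related, whatever the arguments. -/
theorem isTolerance_chainTolerance : IsTolerance expandedLang.{u} chainTolerance.{u} where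
  refl a := ⟨Nat.le_succ _, Nat.le_succ _⟩
  symm a b h := ⟨h.2, h.1⟩
  compatible := by
    intro n f x y h
    cases f with
    | sup =>
      have key : ∀ a b c d : Fin 3, (a.val ≤ b.val + 1 ∧ b.val ≤ a.val + 1) →
          (c.val ≤ d.val + 1 ∧ d.val ≤ c.val + 1) →
          (a ⊔ c).val ≤ (b ⊔ d).val + 1 ∧ (b ⊔ d).val ≤ (a ⊔ c).val + 1 := by decide
      exact key _ _ _ _ (h 0) (h 1)
    | inf =>
      have key : ∀ a b c d : Fin 3, (a.val ≤ b.val + 1 ∧ b.val ≤ a.val + 1) →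
          (c.val ≤ d.val + 1 ∧ d.val ≤ c.val + 1) →
          (a ⊓ c).val ≤ (b ⊓ d).val + 1 ∧ (b ⊓ d).val ≤ (a ⊓ c).val + 1 := by decide
      exact key _ _ _ _ (h 0) (h 1)
    | down =>
      change chainTolerance (if x 0 = ⟨1⟩ then ⟨0⟩ else ⟨1⟩) (if y 0 = ⟨1⟩ then ⟨0⟩ else ⟨1⟩)
      split_ifs <;> simp [chainTolerance]
    | up =>
      change chainTolerance (if x 0 = ⟨1⟩ then ⟨2⟩ else ⟨1⟩) (if y 0 = ⟨1⟩ then ⟨2⟩ else ⟨1⟩)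
      split_ifs <;> simp [chainTolerance]

/-- Some `R k ∘ (R k)⁻` must omit (0, 2), yet it contains (0, 1). The unary operations turn any
witness for (0, 1) into one for (0, 2). -/
theorem not_isWeaklyRepresentable_chainTolerance :
    ¬ IsWeaklyRepresentable expandedLang.{u} chainTolerance.{u} := by
  rintro ⟨K, R, hr, hc, hR⟩
  have h02 : ¬ chainTolerance.{u} ⟨0⟩ ⟨2⟩ := by simp [chainTolerance]
  have h01 : chainTolerance.{u} ⟨0⟩ ⟨1⟩ := by simp [chainTolerance]
  rw [hR] at h02
  push Not at h02
  obtain ⟨k, hk⟩ := h02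
  have hdown {a b : ULift.{u} (Fin 3)} (h : R k a b) :
      R k (if a = ⟨1⟩ then ⟨0⟩ else ⟨1⟩) (if b = ⟨1⟩ then ⟨0⟩ else ⟨1⟩) :=
    hc k 1 ExpandedFunctions.down (fun _ => a) (fun _ => b) fun _ => h
  have hup {a b : ULift.{u} (Fin 3)} (h : R k a b) :
      R k (if a = ⟨1⟩ then ⟨2⟩ else ⟨1⟩) (if b = ⟨1⟩ then ⟨2⟩ else ⟨1⟩) :=
    hc k 1 ExpandedFunctions.up (fun _ => a) (fun _ => b) fun _ => h
  -- From `1 R 0`, `down` yields `0 R 1` and `up` yields `2 R 1`, so 1 is a common `R`-successor of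
  -- 0 and 2.
  have h10 (h : R k ⟨1⟩ ⟨0⟩) : False :=
    hk ⟨⟨1⟩, by simpa [ULift.ext_iff] using hdown h, by simpa [flip, ULift.ext_iff] using hup h⟩
  -- Here `0 R c` and `1 R c`. For `c = 1`, `down` turns `0 R 1` into `1 R 0`; for `c = 2`,
  -- reflexivity makes 2 itself the common successor of 0 and 2.
  obtain ⟨⟨c⟩, hac, hbc⟩ := (hR _ _).1 h01 k
  fin_cases c
  · exact h10 hbc
  · exact h10 (by simpa [ULift.ext_iff] using hdown hac)
  · exact hk ⟨⟨2⟩, hac, hr k _⟩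

theorem not_tolerancesWeaklyRepresentable_expandedVariety :
    ¬ expandedVariety.{u}.TolerancesWeaklyRepresentable := fun h =>
  not_isWeaklyRepresentable_chainTolerance
    (@h _ chainStructure expandedVariety_mem_chain _ isTolerance_chainTolerance)

/-- A class of varieties containing the lattices but not their expansions by two unary operations
is not characterized by a weak Mal'cev condition. -/
theorem not_characterizedByWeakMalcev {C : Variety.{u} → Prop} (h : C latticeVariety)
    (h' : ¬ C expandedVariety) : ¬ CharacterizedByWeakMalcev C := fun ⟨_, hW⟩ =>
  h' ((hW _).2 (((hW _).1 h).of_lhom (V := latticeVariety) (V' := expandedVariety)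
    latticeInclusion fun e he => ⟨e, he, rfl⟩))

end UnivAlg

theorem corollary4 :
    ¬ UnivAlg.CharacterizedByWeakMalcev.{u} UnivAlg.Variety.TolerancesRepresentable.{u} ∧
    ¬ UnivAlg.CharacterizedByWeakMalcev.{u}
        UnivAlg.Variety.TolerancesWeaklyRepresentable.{u} :=
  ⟨UnivAlg.not_characterizedByWeakMalcev UnivAlg.latticeVariety_tolerancesRepresentable
    fun h => UnivAlg.not_tolerancesWeaklyRepresentable_expandedVariety
      h.tolerancesWeaklyRepresentable,
  UnivAlg.not_characterizedByWeakMalcev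
    UnivAlg.latticeVariety_tolerancesRepresentable.tolerancesWeaklyRepresentable
    UnivAlg.not_tolerancesWeaklyRepresentable_expandedVariety⟩
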